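/- Let $\mathbb{D}$ be the open unit disc of $\mathbb{C}$ and let $dA$ be the normalized area measure on $\mathbb{D}$. For $0<\alpha<1$ and $p>0$, let $A^p_\alpha$ be the set of all holomorphic functions $f$ on $\mathbb{D}$ such that $$\int_{\mathbb{D}} |f(z)|^{p-2}\,|f'(z)|^2\,(1-|z|^2)^{\alpha}\,dA(z)<\infty .$$ Let $0<\alpha<1$ and $p>0$ with $p\neq 2$ and $\alpha+p>\tfrac12$. Then there exist $f,g\in A^p_\alpha$ such that $f+g\notin A^p_\alpha$. In particular, $A^p_\alpha$ is not a vector space (with pointwise operations). -/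

import Mathlib

open MeasureTheory

noncomputable section

/-- The area measure `dA` on the open unit disc of `ℂ`, normalized to have total mass `1`. -/
def discArea : Measure ℂ :=
  (ENNReal.ofReal Real.pi)⁻¹ • (volume : Measure ℂ).restrict (Metric.ball 0 1)

/-- The integral `∫ |f(z)|^(p-2) |f'(z)|^2 (1 - |z|^2)^α dA(z)` over the unit disc, as a value
in `[0, ∞]`.  The integrand takes the value `0` at the zeros of `f` if `p < 2`. This does
not affect the integral for holomorphic `f`: the zeros are isolated unless `f` vanishes
identically on the disc, and in that case `f' = 0`. -/
def dirichletEnergy (α p : ℝ) (f : ℂ → ℂ) : ENNReal :=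
  ∫⁻ z, ENNReal.ofReal (‖f z‖ ^ (p - 2) * ‖deriv f z‖ ^ 2 * (1 - ‖z‖ ^ 2) ^ α) ∂discArea

/-- The class `A^p_α` for `0 < α < 1` and `p > 0`: the functions holomorphic in the open
unit disc with `∫ |f|^(p-2) |f'|^2 (1 - |z|^2)^α dA < ∞`. A function on the disc is represented
by a function on `ℂ`, and membership depends only on its values in the open disc. -/
def classA (α p : ℝ) : Set (ℂ → ℂ) :=
  {f | DifferentiableOn ℂ f (Metric.ball 0 1) ∧ dirichletEnergy α p f < ⊤}

end

open MeasureTheory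

/-! The Cayley transform carries the integral to the half-plane `s = Re w > 0`, where the weight is
`(4s / r²)^α` with `r = ‖1 + w‖`. Take `E = (1 + w)^b e^{-w}` and `P = 2(1 + w)^c`. Differentiating
`P` gains a factor `r⁻¹`, while `E'` is of the same order as `E`. Counting powers of `r`, `cp < α`
puts `P` in the class. Because `e^{-w}` confines `E` to bounded `s`, the threshold for `E` is `bp <
2α - 1`, with logarithmic divergence at equality. For `b ≤ c < b + 1` the sum `E + P` has the
modulus of `P` but, in a vertical strip, the derivative of `E`. Its critical condition is therefore
`2α - 2b - c(p - 2) > 1`, which depends on `c` as soon as `p ≠ 2`. The gap `2α - 1 < α` leaves room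
to choose `c`. If `p < 2`, a large `P` damps the factor `‖f‖^(p - 2)`: `E + P` and `-P` belong to
the class, but their sum `E` does not (`expPower_add_twicePower_mem`, `expPower_notMem`). If `p >
2`, `P` amplifies that factor: `E` and `P` belong, but `E + P` does not
(`expPower_add_twicePower_notMem`). -/

/-- The open right half-plane of `ℂ`. -/
def rightHalfPlane : Set ℂ := {w | 0 < w.re}

/-- The energy density of `U ∘ φ` transported to the right half-plane by the Cayley transform
`φ z = (1 + z) / (1 - z)`. -/
noncomputable def halfPlaneDensity (α p : ℝ) (U : ℂ → ℂ) (w : ℂ) : ℝ :=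
  ‖U w‖ ^ (p - 2) * ‖deriv U w‖ ^ 2 * (4 * w.re / ‖1 + w‖ ^ 2) ^ α

/-! ### The Cayley transform and the conformal change of variables -/

lemma isOpen_rightHalfPlane : IsOpen rightHalfPlane :=
  isOpen_lt continuous_const Complex.continuous_re

lemma one_add_ne_zero_of_mem_rightHalfPlane {w : ℂ} (hw : w ∈ rightHalfPlane) : 1 + w ≠ 0 := by
  intro h
  have := congrArg Complex.re h
  simp only [Complex.add_re, Complex.one_re, Complex.zero_re] at this
  have : 0 < w.re := hw
  linarith

lemma one_sub_ne_zero_of_mem_ball {z : ℂ} (hz : z ∈ Metric.ball (0 : ℂ) 1) : 1 - z ≠ 0 := by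
  intro h
  have : z = 1 := (sub_eq_zero.1 h).symm
  simp [this] at hz

lemma one_sub_sq_norm_cayley {w : ℂ} (hw : 1 + w ≠ 0) :
    1 - ‖(w - 1) / (1 + w)‖ ^ 2 = 4 * w.re / ‖1 + w‖ ^ 2 := by
  have h : ‖1 + w‖ ^ 2 ≠ 0 := by simpa using hw
  rw [norm_div, div_pow, eq_div_iff h, sub_mul, div_mul_cancel₀ _ h, ← Complex.normSq_eq_norm_sq,
    ← Complex.normSq_eq_norm_sq]
  simp [Complex.normSq_apply]
  ring

lemma cayley_mem_ball_iff {w : ℂ} (hw : 1 + w ≠ 0) :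
    (w - 1) / (1 + w) ∈ Metric.ball (0 : ℂ) 1 ↔ w ∈ rightHalfPlane := by
  have h : 0 < ‖1 + w‖ ^ 2 := by positivity
  have h1 := one_sub_sq_norm_cayley hw
  rw [mem_ball_zero_iff, rightHalfPlane, Set.mem_ofPred_eq]
  constructor
  · intro h2
    have : 0 < 4 * w.re / ‖1 + w‖ ^ 2 := by
      rw [← h1]; nlinarith [norm_nonneg ((w - 1) / (1 + w))]
    have := (div_pos_iff_of_pos_right h).1 this
    linarith
  · intro h2
    have : 0 < 4 * w.re / ‖1 + w‖ ^ 2 := by positivity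
    rw [← h1] at this
    nlinarith [norm_nonneg ((w - 1) / (1 + w))]

lemma cayley_leftInverse {w : ℂ} (hw : 1 + w ≠ 0) :
    (1 + (w - 1) / (1 + w)) / (1 - (w - 1) / (1 + w)) = w := by
  have h1 : 1 + (w - 1) / (1 + w) = 2 * w / (1 + w) := by field_simp; ring
  have h2 : 1 - (w - 1) / (1 + w) = 2 / (1 + w) := by field_simp; ring
  rw [h1, h2]
  field_simp

lemma cayley_rightInverse {z : ℂ} (hz : 1 - z ≠ 0) :
    1 + (1 + z) / (1 - z) ≠ 0 ∧
      ((1 + z) / (1 - z) - 1) / (1 + (1 + z) / (1 - z)) = z := by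
  have h1 : 1 + (1 + z) / (1 - z) = 2 / (1 - z) := by field_simp; ring
  have h2 : (1 + z) / (1 - z) - 1 = 2 * z / (1 - z) := by field_simp; ring
  rw [h1, h2]
  exact ⟨div_ne_zero two_ne_zero hz, by field_simp⟩

lemma image_cayley_rightHalfPlane :
    (fun w : ℂ ↦ (w - 1) / (1 + w)) '' rightHalfPlane = Metric.ball 0 1 := by
  ext z
  constructor
  · rintro ⟨w, hw, rfl⟩
    exact (cayley_mem_ball_iff (one_add_ne_zero_of_mem_rightHalfPlane hw)).2 hw
  · intro hz
    obtain ⟨h1, h2⟩ := cayley_rightInverse (one_sub_ne_zero_of_mem_ball hz)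
    exact ⟨_, (cayley_mem_ball_iff h1).1 (by rwa [h2]), h2⟩

lemma injOn_cayley : Set.InjOn (fun w : ℂ ↦ (w - 1) / (1 + w)) rightHalfPlane := by
  intro w hw w' hw' h
  have h1 := cayley_leftInverse (one_add_ne_zero_of_mem_rightHalfPlane hw)
  have h2 := cayley_leftInverse (one_add_ne_zero_of_mem_rightHalfPlane hw')
  simp only at h
  rw [← h1, ← h2, h]

lemma mapsTo_cayley_ball :
    Set.MapsTo (fun z : ℂ ↦ (1 + z) / (1 - z)) (Metric.ball 0 1) rightHalfPlane := by
  intro z hz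
  obtain ⟨h1, h2⟩ := cayley_rightInverse (one_sub_ne_zero_of_mem_ball hz)
  exact (cayley_mem_ball_iff h1).1 (by rwa [h2])

lemma det_restrictScalars_toSpanSingleton (c : ℂ) :
    ((ContinuousLinearMap.toSpanSingleton ℂ c).restrictScalars ℝ).det = ‖c‖ ^ 2 := by
  rw [← Complex.normSq_eq_norm_sq, ← Algebra.norm_complex_apply, Algebra.norm_apply]
  unfold ContinuousLinearMap.det
  congr 1
  ext; simp [mul_comm]

lemma hasDerivAt_cayley {w : ℂ} (hw : 1 + w ≠ 0) :
    HasDerivAt (fun w : ℂ ↦ (w - 1) / (1 + w)) (2 / (1 + w) ^ 2) w := by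
  have := ((hasDerivAt_id w).sub_const 1).div ((hasDerivAt_id w).const_add 1) hw
  refine this.congr_deriv ?_
  simp
  ring

lemma hasDerivAt_cayley_symm {z : ℂ} (hz : 1 - z ≠ 0) :
    HasDerivAt (fun z : ℂ ↦ (1 + z) / (1 - z)) (2 / (1 - z) ^ 2) z := by
  have := ((hasDerivAt_id z).const_add 1).div ((hasDerivAt_id z).const_sub 1) hz
  refine this.congr_deriv ?_
  simp
  ring

lemma differentiableOn_comp_cayley {U : ℂ → ℂ} (hU : DifferentiableOn ℂ U rightHalfPlane) :
    DifferentiableOn ℂ (fun z ↦ U ((1 + z) / (1 - z))) (Metric.ball 0 1) :=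
  hU.comp (fun _ hz ↦ (hasDerivAt_cayley_symm
    (one_sub_ne_zero_of_mem_ball hz)).differentiableAt.differentiableWithinAt) mapsTo_cayley_ball

/-- Conformal invariance: the Jacobian of the inverse Cayley map cancels the squared modulus of the
derivative in the chain rule, so only the weight changes. -/
lemma dirichletEnergy_comp_cayley (α p : ℝ) {U : ℂ → ℂ}
    (hU : DifferentiableOn ℂ U rightHalfPlane) :
    dirichletEnergy α p (fun z ↦ U ((1 + z) / (1 - z))) =
      (ENNReal.ofReal Real.pi)⁻¹ *
        ∫⁻ w in rightHalfPlane, ENNReal.ofReal (halfPlaneDensity α p U w) := by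
  rw [dirichletEnergy, discArea, lintegral_smul_measure, smul_eq_mul]
  congr 1
  rw [← image_cayley_rightHalfPlane, lintegral_image_eq_lintegral_abs_det_fderiv_mul volume
    isOpen_rightHalfPlane.measurableSet (fun w hw ↦ ((hasDerivAt_cayley
      (one_add_ne_zero_of_mem_rightHalfPlane hw)).hasFDerivAt.restrictScalars
        ℝ).hasFDerivWithinAt) injOn_cayley]
  refine setLIntegral_congr_fun isOpen_rightHalfPlane.measurableSet fun w hw ↦ ?_
  have h0 := one_add_ne_zero_of_mem_rightHalfPlane hw
  rw [det_restrictScalars_toSpanSingleton, ← ENNReal.ofReal_mul (abs_nonneg _), abs_sq,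
    one_sub_sq_norm_cayley h0, cayley_leftInverse h0]
  have h2 : 1 - (w - 1) / (1 + w) = 2 / (1 + w) := by field_simp; ring
  have hd : HasDerivAt (fun z ↦ U ((1 + z) / (1 - z)))
      (deriv U w * (2 / (1 - (w - 1) / (1 + w)) ^ 2)) ((w - 1) / (1 + w)) := by
    refine HasDerivAt.comp (h₂ := U) _ ?_ (hasDerivAt_cayley_symm ?_)
    · rw [cayley_leftInverse h0]
      exact (hU.differentiableAt (isOpen_rightHalfPlane.mem_nhds hw)).hasDerivAt
    · rw [h2]; exact div_ne_zero two_ne_zero h0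
  rw [hd.deriv, h2, halfPlaneDensity]
  congr 1
  have hn : ‖1 + w‖ ≠ 0 := by simpa using h0
  simp only [norm_mul, norm_div, norm_pow, Complex.norm_two]
  field_simp

lemma comp_cayley_mem_classA_iff (α p : ℝ) {U : ℂ → ℂ}
    (hU : DifferentiableOn ℂ U rightHalfPlane) :
    (fun z ↦ U ((1 + z) / (1 - z))) ∈ classA α p ↔
      ∫⁻ w in rightHalfPlane, ENNReal.ofReal (halfPlaneDensity α p U w) < ⊤ := by
  have hπ : (ENNReal.ofReal Real.pi)⁻¹ ≠ ⊤ := by simp [Real.pi_pos]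
  rw [classA, Set.mem_ofPred_eq, and_iff_right (differentiableOn_comp_cayley hU),
    dirichletEnergy_comp_cayley α p hU, ENNReal.mul_lt_top_iff]
  simp only [hπ.lt_top, true_and, ENNReal.inv_eq_zero, ENNReal.ofReal_ne_top, false_or]
  exact or_iff_left_of_imp fun h ↦ h ▸ ENNReal.zero_lt_top

/-! ### Convergence and divergence tests on the half-plane -/

lemma lintegral_rightHalfPlane_lt_top_of_le {G : ℂ → ℝ} {C a b : ℝ} (ha : 1 < a)
    (hb : 1 < b)
    (hG : ∀ w ∈ rightHalfPlane, G w ≤ C * ((1 + |w.re|) ^ (-a) * (1 + |w.im|) ^ (-b))) :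
    ∫⁻ w in rightHalfPlane, ENNReal.ofReal (G w) < ⊤ := by
  have hm : ∀ c : ℝ, 1 < c → Integrable (fun x : ℝ ↦ (1 + |x|) ^ (-c)) := fun c hc ↦ by
    have := integrable_one_add_norm (E := ℝ) (μ := volume) (r := c) (by simpa using hc)
    simpa only [Real.norm_eq_abs] using this
  have hint : Integrable (fun z : ℝ × ℝ ↦
      C * ((1 + |z.1|) ^ (-a) * (1 + |z.2|) ^ (-b))) :=
    ((hm a ha).mul_prod (hm b hb)).const_mul C
  have hint' := (Complex.volume_preserving_equiv_real_prod.integrable_comp_emb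
    Complex.measurableEquivRealProd.measurableEmbedding).2 hint
  refine lt_of_le_of_lt (setLIntegral_mono' isOpen_rightHalfPlane.measurableSet
    (fun w hw ↦ ENNReal.ofReal_le_ofReal (hG w hw))) ?_
  exact lt_of_le_of_lt (setLIntegral_le_lintegral _ _) hint'.lintegral_lt_top

lemma one_add_re_le_norm {w : ℂ} : 1 + w.re ≤ ‖1 + w‖ := by
  simpa using Complex.re_le_norm (1 + w)

lemma one_add_abs_im_div_two_le_norm {w : ℂ} (hw : w ∈ rightHalfPlane) :
    (1 + |w.im|) / 2 ≤ ‖1 + w‖ := by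
  have h1 := one_add_re_le_norm (w := w)
  have h2 : |w.im| ≤ ‖1 + w‖ := by simpa using Complex.abs_im_le_norm (1 + w)
  have : 0 < w.re := hw
  linarith

lemma norm_one_add_rpow_neg_le {w : ℂ} (hw : w ∈ rightHalfPlane) {b : ℝ} (hb : 0 ≤ b) :
    ‖1 + w‖ ^ (-b) ≤ 2 ^ b * (1 + |w.im|) ^ (-b) := by
  have h := one_add_abs_im_div_two_le_norm hw
  have h0 : 0 < (1 + |w.im|) / 2 := by positivity
  refine (Real.rpow_le_rpow_of_nonpos h0 h (by linarith)).trans_eq ?_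
  rw [Real.div_rpow (by positivity) zero_le_two, Real.rpow_neg zero_le_two b, div_inv_eq_mul,
    mul_comm]

lemma lintegral_re_rpow_mul_norm_rpow_lt_top {α e C : ℝ} (hα : 0 < α) (he : 2 + α < e)
    (hC : 0 ≤ C) :
    ∫⁻ w in rightHalfPlane, ENNReal.ofReal (C * (w.re ^ α * ‖1 + w‖ ^ (-e))) < ⊤ := by
  -- The surplus in the exponent is split equally, so that `re` and `im` each receive decay of order
  -- `1 + η`.
  set η := (e - (2 + α)) / 2 with hη
  have hη0 : 0 < η := by rw [hη]; linarith
  refine lintegral_rightHalfPlane_lt_top_of_le (C := C * 2 ^ (1 + η)) (a := 1 + η) (b := 1 + η)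
    (by linarith) (by linarith) fun w hw ↦ ?_
  have hs : 0 < w.re := hw
  rw [mul_assoc]
  refine mul_le_mul_of_nonneg_left ?_ hC
  have hr : 0 < ‖1 + w‖ := by linarith [one_add_re_le_norm (w := w)]
  rw [abs_of_pos hs]
  calc w.re ^ α * ‖1 + w‖ ^ (-e)
      = w.re ^ α * ‖1 + w‖ ^ (-(1 + α + η)) * ‖1 + w‖ ^ (-(1 + η)) := by
        rw [mul_assoc, ← Real.rpow_add hr]; congr 2; rw [hη]; ring
    _ ≤ (1 + w.re) ^ α * (1 + w.re) ^ (-(1 + α + η)) *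
        (2 ^ (1 + η) * (1 + |w.im|) ^ (-(1 + η))) := by
        gcongr ?_ * ?_ * ?_
        · exact Real.rpow_le_rpow hs.le (by linarith) hα.le
        · exact Real.rpow_le_rpow_of_nonpos (by linarith) one_add_re_le_norm (by linarith)
        · exact norm_one_add_rpow_neg_le hw (by linarith)
    _ = _ := by
        rw [← Real.rpow_add (by linarith)]
        ring_nf

lemma lintegral_exp_mul_re_rpow_mul_norm_rpow_lt_top {α e q C : ℝ} (hα : 0 < α) (hα1 : α < 1)
    (he : 1 < e) (hq : 0 < q) (hC : 0 ≤ C) :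
    ∫⁻ w in rightHalfPlane, ENNReal.ofReal
      (C * (Real.exp (-(q * w.re)) * w.re ^ α * ‖1 + w‖ ^ (-e))) < ⊤ := by
  refine lintegral_rightHalfPlane_lt_top_of_le (C := C * (6 * Real.exp q / q ^ 3 * 2 ^ e))
    (a := 2) (b := e) (by linarith) (by linarith) fun w hw ↦ ?_
  have hs : 0 < w.re := hw
  rw [mul_assoc C (6 * Real.exp q / q ^ 3 * 2 ^ e)]
  refine mul_le_mul_of_nonneg_left ?_ hC
  rw [abs_of_pos hs]
  -- From `x³ / 3! ≤ e^x` at `x = q(1 + s)`. Cubic decay leaves `(1 + s)^(-2)` after `s^α ≤ 1 + s`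
  -- is absorbed.
  have h1 : Real.exp (-(q * w.re)) ≤ 6 * Real.exp q / q ^ 3 * (1 + w.re) ^ (-3 : ℝ) := by
    have h := Real.pow_div_factorial_le_exp (x := q * (1 + w.re)) (by positivity) 3
    rw [show Real.exp (q * (1 + w.re)) = Real.exp q * Real.exp (q * w.re) by
      rw [← Real.exp_add]; ring_nf, mul_pow] at h
    rw [Real.exp_neg, Real.rpow_neg (by linarith), ← div_eq_mul_inv, div_div, inv_eq_one_div,
      div_le_div_iff₀ (by positivity) (by positivity)]
    norm_num [Nat.factorial] at h ⊢
    linarith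
  have h2 : w.re ^ α ≤ (1 + w.re) ^ (1 : ℝ) :=
    (Real.rpow_le_rpow hs.le (by linarith) hα.le).trans
      (Real.rpow_le_rpow_of_exponent_le (by linarith) hα1.le)
  calc Real.exp (-(q * w.re)) * w.re ^ α * ‖1 + w‖ ^ (-e)
      ≤ 6 * Real.exp q / q ^ 3 * (1 + w.re) ^ (-3 : ℝ) * (1 + w.re) ^ (1 : ℝ) *
        (2 ^ e * (1 + |w.im|) ^ (-e)) := by
        gcongr ?_ * ?_ * ?_
        exact norm_one_add_rpow_neg_le hw (by linarith)
    _ = 6 * Real.exp q / q ^ 3 * ((1 + w.re) ^ (-3 : ℝ) * (1 + w.re) ^ (1 : ℝ)) *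
        (2 ^ e * (1 + |w.im|) ^ (-e)) := by ring
    _ = _ := by
        rw [← Real.rpow_add (by linarith)]
        norm_num
        ring

/-- On this half-strip `‖1 + w‖ ≤ 2 + im w ≤ 2 im w`, so the integral dominates a multiple of the
divergent `∫ dy / y`. -/
lemma lintegral_rightHalfPlane_eq_top_of_le {G : ℂ → ℝ} {δ T : ℝ} (hδ : 0 < δ) (hT : 2 ≤ T)
    (hG : ∀ w : ℂ, 1 / 2 < w.re → w.re < 1 → T < w.im → δ * ‖1 + w‖⁻¹ ≤ G w) :
    ∫⁻ w in rightHalfPlane, ENNReal.ofReal (G w) = ⊤ := by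
  have hT0 : 0 < T := by linarith
  set S : Set (ℝ × ℝ) := Set.Ioo (1 / 2) 1 ×ˢ Set.Ioi T
  have hS : MeasurableSet S := measurableSet_Ioo.prod measurableSet_Ioi
  have hsub : Complex.measurableEquivRealProd ⁻¹' S ⊆ rightHalfPlane := by
    rintro w ⟨⟨h1, -⟩, -⟩
    change 1 / 2 < w.re at h1
    change 0 < w.re
    linarith
  refine top_le_iff.1 (le_trans ?_ (lintegral_mono_set hsub))
  have hmono : ∫⁻ w in Complex.measurableEquivRealProd ⁻¹' S,
      ENNReal.ofReal (δ / 2 * (Complex.measurableEquivRealProd w).2⁻¹) ≤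
      ∫⁻ w in Complex.measurableEquivRealProd ⁻¹' S, ENNReal.ofReal (G w) := by
    refine setLIntegral_mono' (Complex.measurableEquivRealProd.measurable hS) fun w hw ↦ ?_
    obtain ⟨⟨h1, h2⟩, h3⟩ := hw
    change 1 / 2 < w.re at h1
    change w.re < 1 at h2
    change T < w.im at h3
    refine ENNReal.ofReal_le_ofReal (le_trans ?_ (hG w h1 h2 h3))
    change δ / 2 * w.im⁻¹ ≤ _
    have hr : ‖1 + w‖ ≤ 2 * w.im := by
      have := Complex.norm_le_abs_re_add_abs_im (1 + w)
      simp only [Complex.add_re, Complex.one_re, Complex.add_im, Complex.one_im, zero_add] at this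
      rw [abs_of_pos (by linarith), abs_of_pos (by linarith)] at this
      linarith
    have hr0 : 0 < ‖1 + w‖ := by linarith [one_add_re_le_norm (w := w)]
    have : (2 * w.im)⁻¹ ≤ ‖1 + w‖⁻¹ := inv_anti₀ hr0 hr
    rw [mul_inv] at this
    nlinarith
  refine le_trans ?_ hmono
  rw [Complex.volume_preserving_equiv_real_prod.setLIntegral_comp_preimage_emb
    Complex.measurableEquivRealProd.measurableEmbedding
    (fun z : ℝ × ℝ ↦ ENNReal.ofReal (δ / 2 * z.2⁻¹)) S, Measure.volume_eq_prod,
    setLIntegral_prod _ (by fun_prop)]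
  have hin : ∫⁻ y in Set.Ioi T, ENNReal.ofReal (δ / 2 * y⁻¹) = ⊤ := by
    by_contra hne
    have hI : IntegrableOn (fun y : ℝ ↦ δ / 2 * y⁻¹) (Set.Ioi T) := by
      refine ⟨by fun_prop, ?_⟩
      rw [hasFiniteIntegral_iff_ofReal]
      · exact lt_top_iff_ne_top.2 hne
      · filter_upwards [ae_restrict_mem measurableSet_Ioi] with y hy
        have : 0 < y := hT0.trans hy
        simp only [Pi.zero_apply]
        positivity
    have := hI.const_mul (δ / 2)⁻¹
    refine not_integrableOn_Ioi_inv (a := T) ?_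
    refine IntegrableOn.congr_fun this (fun y _ ↦ ?_) measurableSet_Ioi
    rw [inv_mul_cancel_left₀ (by positivity)]
  simp only [hin]
  rw [setLIntegral_const, Real.volume_Ioo, ENNReal.top_mul]
  norm_num

/-! ### The two test functions and their size estimates -/

/-- `(1 + w) ^ b * exp (-w)`, a power times the Cayley transform of a singular inner function. -/
noncomputable def expPower (b : ℝ) (w : ℂ) : ℂ := (1 + w) ^ (b : ℂ) * Complex.exp (-w)

/-- `2 * (1 + w) ^ c`. -/
noncomputable def twicePower (c : ℝ) (w : ℂ) : ℂ := 2 * (1 + w) ^ (c : ℂ)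

lemma hasDerivAt_one_add_cpow (b : ℝ) {w : ℂ} (hw : w ∈ rightHalfPlane) :
    HasDerivAt (fun w : ℂ ↦ (1 + w) ^ (b : ℂ)) (b * (1 + w) ^ ((b - 1 : ℝ) : ℂ)) w := by
  have hs : 0 < w.re := hw
  have h := ((hasDerivAt_id w).const_add 1).cpow_const (c := (b : ℂ))
    (Or.inl (by simp only [id, Complex.add_re, Complex.one_re]; linarith))
  simpa using h

lemma hasDerivAt_expPower (b : ℝ) {w : ℂ} (hw : w ∈ rightHalfPlane) :
    HasDerivAt (expPower b)
      (b * (1 + w) ^ ((b - 1 : ℝ) : ℂ) * Complex.exp (-w) +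
        (1 + w) ^ (b : ℂ) * -Complex.exp (-w)) w := by
  refine (hasDerivAt_one_add_cpow b hw).mul ?_
  simpa using (hasDerivAt_neg w).cexp

lemma hasDerivAt_twicePower (c : ℝ) {w : ℂ} (hw : w ∈ rightHalfPlane) :
    HasDerivAt (twicePower c) (2 * (c * (1 + w) ^ ((c - 1 : ℝ) : ℂ))) w :=
  (hasDerivAt_one_add_cpow c hw).const_mul 2

lemma differentiableOn_expPower (b : ℝ) : DifferentiableOn ℂ (expPower b) rightHalfPlane :=
  fun _ hw ↦ (hasDerivAt_expPower b hw).differentiableAt.differentiableWithinAt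

lemma differentiableOn_twicePower (c : ℝ) : DifferentiableOn ℂ (twicePower c) rightHalfPlane :=
  fun _ hw ↦ (hasDerivAt_twicePower c hw).differentiableAt.differentiableWithinAt

lemma norm_expPower (b : ℝ) (w : ℂ) : ‖expPower b w‖ = Real.exp (-w.re) * ‖1 + w‖ ^ b := by
  rw [expPower, norm_mul, Complex.norm_cpow_real, Complex.norm_exp, Complex.neg_re, mul_comm]

lemma norm_twicePower (c : ℝ) (w : ℂ) : ‖twicePower c w‖ = 2 * ‖1 + w‖ ^ c := by
  rw [twicePower, norm_mul, Complex.norm_cpow_real, Complex.norm_two]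

lemma norm_deriv_twicePower (c : ℝ) {w : ℂ} (hw : w ∈ rightHalfPlane) :
    ‖deriv (twicePower c) w‖ = 2 * |c| * ‖1 + w‖ ^ (c - 1) := by
  rw [(hasDerivAt_twicePower c hw).deriv, norm_mul, norm_mul, Complex.norm_cpow_real,
    Complex.norm_two, Complex.norm_real, Real.norm_eq_abs, mul_assoc]

lemma one_lt_norm_one_add {w : ℂ} (hw : w ∈ rightHalfPlane) : 1 < ‖1 + w‖ := by
  have hs : 0 < w.re := hw
  linarith [one_add_re_le_norm (w := w)]

lemma norm_deriv_expPower_le (b : ℝ) {w : ℂ} (hw : w ∈ rightHalfPlane) :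
    ‖deriv (expPower b) w‖ ≤ (|b| + 1) * Real.exp (-w.re) * ‖1 + w‖ ^ b := by
  rw [(hasDerivAt_expPower b hw).deriv]
  refine (norm_add_le _ _).trans ?_
  simp only [norm_mul, norm_neg, Complex.norm_cpow_real, Complex.norm_exp, Complex.neg_re,
    Complex.norm_real, Real.norm_eq_abs]
  have h : ‖1 + w‖ ^ (b - 1) ≤ ‖1 + w‖ ^ b :=
    Real.rpow_le_rpow_of_exponent_le (one_lt_norm_one_add hw).le (by linarith)
  have := mul_le_mul_of_nonneg_left h (mul_nonneg (abs_nonneg b) (Real.exp_pos (-w.re)).le)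
  linarith

/-- The logarithmic derivative is `b / (1 + w) - 1`, of modulus at least `1/2` in this range. -/
lemma le_norm_deriv_expPower (b : ℝ) {w : ℂ} (hw : w ∈ rightHalfPlane) (hb : 2 * |b| ≤ ‖1 + w‖) :
    Real.exp (-w.re) / 2 * ‖1 + w‖ ^ b ≤ ‖deriv (expPower b) w‖ := by
  rw [(hasDerivAt_expPower b hw).deriv, add_comm (_ * _ * _)]
  refine le_trans ?_ (norm_sub_le_norm_add _ _)
  simp only [norm_mul, norm_neg, Complex.norm_cpow_real, Complex.norm_exp, Complex.neg_re,
    Complex.norm_real, Real.norm_eq_abs]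
  have hr : 0 < ‖1 + w‖ := by linarith [one_lt_norm_one_add hw]
  have h : |b| * ‖1 + w‖ ^ (b - 1) ≤ ‖1 + w‖ ^ b / 2 := by
    rw [Real.rpow_sub_one hr.ne', mul_div_assoc', div_le_div_iff₀ hr two_pos]
    nlinarith [Real.rpow_pos_of_pos hr b]
  have := mul_le_mul_of_nonneg_left h (Real.exp_pos (-w.re)).le
  linarith

/-- The factor `2` in `twicePower` serves this bound: one copy of `‖1 + w‖ ^ c` absorbs `expPower
b`, the other survives. -/
lemma norm_expPower_add_twicePower {b c : ℝ} (hbc : b ≤ c) {w : ℂ} (hw : w ∈ rightHalfPlane) :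
    ‖1 + w‖ ^ c ≤ ‖(expPower b + twicePower c) w‖ := by
  have hs : 0 < w.re := hw
  have h1 : ‖expPower b w‖ ≤ ‖1 + w‖ ^ c := by
    rw [norm_expPower]
    calc Real.exp (-w.re) * ‖1 + w‖ ^ b ≤ 1 * ‖1 + w‖ ^ c := by
          gcongr
          · exact Real.exp_le_one_iff.2 (by linarith)
          · exact (one_lt_norm_one_add hw).le
      _ = _ := one_mul _
  have h2 := norm_sub_le_norm_add (twicePower c w) (expPower b w)
  rw [norm_twicePower, add_comm (twicePower c w)] at h2
  rw [Pi.add_apply]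
  linarith

/-! ### Membership and non-membership by power counting -/

lemma model_density_eq {K L r s : ℝ} (hK : 0 < K) (hr : 0 < r) (hs : 0 < s) (α p x y : ℝ) :
    (K * r ^ x) ^ (p - 2) * (L * r ^ y) ^ 2 * (4 * s / r ^ 2) ^ α =
      K ^ (p - 2) * L ^ 2 * 4 ^ α * (s ^ α * r ^ (-(2 * α - 2 * y - x * (p - 2)))) := by
  have h : -(2 * α - 2 * y - x * (p - 2)) = x * (p - 2) + y * 2 - 2 * α := by ring
  rw [h, Real.rpow_sub hr, Real.rpow_add hr, Real.mul_rpow hK.le (by positivity),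
    ← Real.rpow_mul hr.le, mul_pow, Real.div_rpow (by positivity) (by positivity),
    Real.mul_rpow (by norm_num) hs.le, Real.rpow_mul hr.le y 2, Real.rpow_two,
    Real.rpow_mul hr.le 2 α, Real.rpow_two]
  ring

lemma exp_rpow_mul_exp_sq (s p : ℝ) :
    Real.exp (-s) ^ (p - 2) * Real.exp (-s) ^ 2 = Real.exp (-(p * s)) := by
  rw [← Real.exp_mul, ← Real.exp_nat_mul, ← Real.exp_add]
  congr 1
  push_cast
  ring

lemma twicePower_mem {α p c : ℝ} (hα : 0 < α) (hc : c * p < α) :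
    (fun z ↦ twicePower c ((1 + z) / (1 - z))) ∈ classA α p := by
  rw [comp_cayley_mem_classA_iff α p (differentiableOn_twicePower c)]
  have h := lintegral_re_rpow_mul_norm_rpow_lt_top (α := α)
    (e := 2 * α - 2 * (c - 1) - c * (p - 2)) (C := 2 ^ (p - 2) * (2 * |c|) ^ 2 * 4 ^ α)
    hα (by linarith) (by positivity)
  refine lt_of_le_of_lt (setLIntegral_mono' isOpen_rightHalfPlane.measurableSet
    fun w hw ↦ ENNReal.ofReal_le_ofReal ?_) h
  rw [halfPlaneDensity, norm_twicePower, norm_deriv_twicePower c hw,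
    model_density_eq two_pos (by linarith [one_lt_norm_one_add hw]) hw]

lemma expPower_mem {α p b : ℝ} (hα : 0 < α) (hα1 : α < 1) (hp : 0 < p) (hb : b * p < 2 * α - 1) :
    (fun z ↦ expPower b ((1 + z) / (1 - z))) ∈ classA α p := by
  rw [comp_cayley_mem_classA_iff α p (differentiableOn_expPower b)]
  have h := lintegral_exp_mul_re_rpow_mul_norm_rpow_lt_top (α := α)
    (e := 2 * α - 2 * b - b * (p - 2)) (C := (|b| + 1) ^ 2 * 4 ^ α) hα hα1 (by linarith) hp
    (by positivity)
  refine lt_of_le_of_lt (setLIntegral_mono' isOpen_rightHalfPlane.measurableSet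
    fun w hw ↦ ENNReal.ofReal_le_ofReal ?_) h
  have hs : 0 < w.re := hw
  have hle : halfPlaneDensity α p (expPower b) w ≤ (Real.exp (-w.re) * ‖1 + w‖ ^ b) ^ (p - 2) *
      ((|b| + 1) * Real.exp (-w.re) * ‖1 + w‖ ^ b) ^ 2 * (4 * w.re / ‖1 + w‖ ^ 2) ^ α := by
    rw [halfPlaneDensity, norm_expPower]
    gcongr
    exact norm_deriv_expPower_le b hw
  refine hle.trans_eq ?_
  rw [model_density_eq (Real.exp_pos _) (by linarith [one_lt_norm_one_add hw]) hs, mul_pow,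
    ← exp_rpow_mul_exp_sq]
  ring

/-- As `p - 2 ≤ 0`, a lower bound for the modulus of the sum bounds its power from above. Splitting
the squared derivative yields one integral with exponential decay, governed by `he`, and one pure
power integral, governed by `hc`. -/
lemma expPower_add_twicePower_mem {α p b c : ℝ} (hα : 0 < α) (hα1 : α < 1) (hp : p ≤ 2)
    (hbc : b ≤ c) (hc : c * p < α) (he : 1 < 2 * α - 2 * b - c * (p - 2)) :
    (fun z ↦ (expPower b + twicePower c) ((1 + z) / (1 - z))) ∈ classA α p := by
  rw [comp_cayley_mem_classA_iff α p
    ((differentiableOn_expPower b).add (differentiableOn_twicePower c))]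
  have h1 := lintegral_exp_mul_re_rpow_mul_norm_rpow_lt_top (α := α) (q := 2)
    (e := 2 * α - 2 * b - c * (p - 2)) (C := 2 * (|b| + 1) ^ 2 * 4 ^ α) hα hα1 he two_pos
    (by positivity)
  have h2 := lintegral_re_rpow_mul_norm_rpow_lt_top (α := α)
    (e := 2 * α - 2 * (c - 1) - c * (p - 2)) (C := 2 * (2 * |c|) ^ 2 * 4 ^ α)
    hα (by linarith) (by positivity)
  refine lt_of_le_of_lt ?_ (ENNReal.add_lt_top.2 ⟨h1, h2⟩)
  rw [← lintegral_add_left (by fun_prop)]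
  refine setLIntegral_mono' isOpen_rightHalfPlane.measurableSet fun w hw ↦ ?_
  have hs : 0 < w.re := hw
  have hr : 0 < ‖1 + w‖ := by linarith [one_lt_norm_one_add hw]
  rw [← ENNReal.ofReal_add (by positivity) (by positivity)]
  refine ENNReal.ofReal_le_ofReal ?_
  have hd : ‖deriv (expPower b + twicePower c) w‖ ^ 2 ≤
      2 * ((|b| + 1) * Real.exp (-w.re) * ‖1 + w‖ ^ b) ^ 2 +
        2 * (2 * |c| * ‖1 + w‖ ^ (c - 1)) ^ 2 := by
    rw [deriv_add (hasDerivAt_expPower b hw).differentiableAt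
      (hasDerivAt_twicePower c hw).differentiableAt]
    have h3 := norm_add_le (deriv (expPower b) w) (deriv (twicePower c) w)
    rw [norm_deriv_twicePower c hw] at h3
    have h4 := h3.trans (add_le_add_left (norm_deriv_expPower_le b hw) _)
    refine (pow_le_pow_left₀ (norm_nonneg _) h4 2).trans ?_
    rw [← mul_add]
    exact add_sq_le
  have hm : ‖(expPower b + twicePower c) w‖ ^ (p - 2) ≤ (1 * ‖1 + w‖ ^ c) ^ (p - 2) := by
    rw [one_mul]
    exact Real.rpow_le_rpow_of_nonpos (by positivity) (norm_expPower_add_twicePower hbc hw)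
      (by linarith)
  have hle : halfPlaneDensity α p (expPower b + twicePower c) w ≤ (1 * ‖1 + w‖ ^ c) ^ (p - 2) *
      (2 * ((|b| + 1) * Real.exp (-w.re) * ‖1 + w‖ ^ b) ^ 2 +
        2 * (2 * |c| * ‖1 + w‖ ^ (c - 1)) ^ 2) * (4 * w.re / ‖1 + w‖ ^ 2) ^ α := by
    rw [halfPlaneDensity]
    gcongr
  have e1 := model_density_eq (L := (|b| + 1) * Real.exp (-w.re)) one_pos hr hs α p c b
  have e2 := model_density_eq (L := 2 * |c|) one_pos hr hs α p c (c - 1)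
  have e3 : Real.exp (-(2 * w.re)) = Real.exp (-w.re) ^ 2 := by
    rw [← Real.exp_nat_mul]; congr 1; push_cast; ring
  rw [Real.one_rpow] at e1 e2
  rw [e3]
  refine hle.trans_eq ?_
  linear_combination 2 * e1 + 2 * e2

lemma half_rpow_mul_inv_le {α r s C C' : ℝ} (hα : 0 < α) (hs : 1 / 2 < s) (hr : 0 < r)
    (hC : 0 ≤ C) (hCC' : C ≤ C') :
    C * (1 / 2) ^ α * r⁻¹ ≤ C' * (s ^ α * r ^ (-1 : ℝ)) := by
  have hC' := hC.trans hCC'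
  rw [Real.rpow_neg_one, mul_assoc]
  gcongr

lemma expPower_notMem {α p b : ℝ} (hα : 0 < α) (hp : 0 < p) (hb : b * p = 2 * α - 1) :
    (fun z ↦ expPower b ((1 + z) / (1 - z))) ∉ classA α p := by
  rw [comp_cayley_mem_classA_iff α p (differentiableOn_expPower b), not_lt_top_iff]
  -- For `1/2 < s < 1`, `e^{-ps} ≥ e^{-p}` and `s^α ≥ (1/2)^α`; the `1/4` is the square of the `1/2`
  -- in the derivative bound.
  refine lintegral_rightHalfPlane_eq_top_of_le (δ := Real.exp (-p) / 4 * 4 ^ α * (1 / 2) ^ α)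
    (T := max 2 (2 * |b|)) (by positivity) (le_max_left _ _) fun w h1 h2 h3 ↦ ?_
  have hs : 0 < w.re := by linarith
  have hw : w ∈ rightHalfPlane := hs
  have hr : 0 < ‖1 + w‖ := by linarith [one_lt_norm_one_add hw]
  have him : w.im ≤ ‖1 + w‖ := by simpa using Complex.im_le_norm (1 + w)
  have hbr : 2 * |b| ≤ ‖1 + w‖ := ((le_max_right _ _).trans h3.le).trans him
  have hle : (Real.exp (-w.re) * ‖1 + w‖ ^ b) ^ (p - 2) *
      (Real.exp (-w.re) / 2 * ‖1 + w‖ ^ b) ^ 2 * (4 * w.re / ‖1 + w‖ ^ 2) ^ α ≤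
      halfPlaneDensity α p (expPower b) w := by
    rw [halfPlaneDensity, norm_expPower]
    gcongr
    exact le_norm_deriv_expPower b hw hbr
  refine le_trans ?_ hle
  rw [model_density_eq (Real.exp_pos _) hr hs, div_pow, mul_div_assoc', exp_rpow_mul_exp_sq,
    show 2 * α - 2 * b - b * (p - 2) = 1 by linarith]
  refine half_rpow_mul_inv_le hα h1 hr (by positivity) ?_
  norm_num
  gcongr
  nlinarith

lemma expPower_add_twicePower_notMem {α p b c : ℝ} (hα : 0 < α) (hp : 2 ≤ p)
    (hbc : b ≤ c) (hcb : c < b + 1) (he : 2 * α - 2 * b - c * (p - 2) = 1) :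
    (fun z ↦ (expPower b + twicePower c) ((1 + z) / (1 - z))) ∉ classA α p := by
  rw [comp_cayley_mem_classA_iff α p
    ((differentiableOn_expPower b).add (differentiableOn_twicePower c)), not_lt_top_iff]
  -- Since `c - 1 < b`, beyond `M` the derivative of `twicePower c` is at most half of the lower
  -- bound `e⁻¹ r^b / 2` for that of `expPower b`, leaving `e⁻¹ r^b / 4`.
  obtain ⟨M, hM⟩ := Filter.eventually_atTop.1 ((tendsto_rpow_atTop
    (show 0 < b + 1 - c by linarith)).eventually_ge_atTop (8 * |c| / Real.exp (-1)))
  refine lintegral_rightHalfPlane_eq_top_of_le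
    (δ := (Real.exp (-1) / 4) ^ 2 * 4 ^ α * (1 / 2) ^ α)
    (T := max 2 (max (2 * |b|) M)) (by positivity) (le_max_left _ _) fun w h1 h2 h3 ↦ ?_
  have hs : 0 < w.re := by linarith
  have hw : w ∈ rightHalfPlane := hs
  have hr : 0 < ‖1 + w‖ := by linarith [one_lt_norm_one_add hw]
  have him : w.im ≤ ‖1 + w‖ := by simpa using Complex.im_le_norm (1 + w)
  have hmax : max (2 * |b|) M ≤ ‖1 + w‖ := ((le_max_right _ _).trans h3.le).trans him
  have hd : Real.exp (-1) / 4 * ‖1 + w‖ ^ b ≤ ‖deriv (expPower b + twicePower c) w‖ := by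
    rw [deriv_add (hasDerivAt_expPower b hw).differentiableAt
      (hasDerivAt_twicePower c hw).differentiableAt]
    have h4 := norm_sub_le_norm_add (deriv (expPower b) w) (deriv (twicePower c) w)
    rw [norm_deriv_twicePower c hw] at h4
    have h5 := le_norm_deriv_expPower b hw ((le_max_left _ _).trans hmax)
    have h6 : Real.exp (-1) * ‖1 + w‖ ^ b ≤ Real.exp (-w.re) * ‖1 + w‖ ^ b := by
      gcongr
    have h7 := hM _ ((le_max_right _ _).trans hmax)
    rw [div_le_iff₀ (Real.exp_pos _)] at h7
    have h8 : ‖1 + w‖ ^ b = ‖1 + w‖ ^ (b + 1 - c) * ‖1 + w‖ ^ (c - 1) := by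
      rw [← Real.rpow_add hr]; congr 1; ring
    have h9 : 8 * |c| * ‖1 + w‖ ^ (c - 1) ≤ Real.exp (-1) * ‖1 + w‖ ^ b := by
      rw [h8]
      nlinarith [mul_le_mul_of_nonneg_right h7 (Real.rpow_pos_of_pos hr (c - 1)).le]
    linarith
  have hm : (1 * ‖1 + w‖ ^ c) ^ (p - 2) ≤ ‖(expPower b + twicePower c) w‖ ^ (p - 2) := by
    rw [one_mul]
    exact Real.rpow_le_rpow (by positivity) (norm_expPower_add_twicePower hbc hw) (by linarith)
  have hle : (1 * ‖1 + w‖ ^ c) ^ (p - 2) * (Real.exp (-1) / 4 * ‖1 + w‖ ^ b) ^ 2 *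
      (4 * w.re / ‖1 + w‖ ^ 2) ^ α ≤ halfPlaneDensity α p (expPower b + twicePower c) w := by
    rw [halfPlaneDensity]
    gcongr
  refine le_trans ?_ hle
  rw [model_density_eq one_pos hr hs, he, Real.one_rpow, one_mul]
  exact half_rpow_mul_inv_le hα h1 hr (by positivity) le_rfl

/-! ### Choice of exponents -/

lemma exists_add_notMem_classA {α p : ℝ} (hα0 : 0 < α) (hα1 : α < 1) (hp0 : 0 < p)
    (hp2 : p ≠ 2) : ∃ f ∈ classA α p, ∃ g ∈ classA α p, f + g ∉ classA α p := by
  rcases hp2.lt_or_gt with hp | hp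
  -- Here `b` is exactly critical for `expPower`. Equality would hold in the condition for the sum
  -- at `c = b`, and since `p < 2` any larger `c` makes it strict.
  · obtain ⟨m, hm1, hm2⟩ := exists_between (show 2 * α - 1 < α by linarith)
    set b := (2 * α - 1) / p with hb
    set c := m / p with hc
    have hbp : b * p = 2 * α - 1 := div_mul_cancel₀ _ hp0.ne'
    have hcp : c * p = m := div_mul_cancel₀ _ hp0.ne'
    have hbc : b < c := div_lt_div_of_pos_right hm1 hp0
    refine ⟨_, expPower_add_twicePower_mem (b := b) hα0 hα1 hp.le hbc.le (hcp.trans_lt hm2)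
      (by nlinarith), fun z ↦ -twicePower c ((1 + z) / (1 - z)), ?_, ?_⟩
    · obtain ⟨h1, h2⟩ := twicePower_mem (p := p) hα0 (hcp.trans_lt hm2)
      refine ⟨h1.neg, ?_⟩
      simpa only [dirichletEnergy, deriv.fun_neg, norm_neg] using h2
    · convert expPower_notMem hα0 hp0 hbp
      simp
  -- Both exponents sit `ε / p` below their critical values `(2α - 1) / p` and `α / p`; this `ε` is
  -- the value that makes the sum exactly critical.
  · set ε := (1 - α) * (p - 2) / p with hε
    have hε0 : 0 < ε := div_pos (mul_pos (by linarith) (by linarith)) hp0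
    have hεp : ε * p = (1 - α) * (p - 2) := div_mul_cancel₀ _ hp0.ne'
    set b := (2 * α - 1 - ε) / p with hb
    set c := (α - ε) / p with hc
    have hbp : b * p = 2 * α - 1 - ε := div_mul_cancel₀ _ hp0.ne'
    have hcp : c * p = α - ε := div_mul_cancel₀ _ hp0.ne'
    refine ⟨_, expPower_mem (b := b) hα0 hα1 hp0 (by linarith), _,
      twicePower_mem (c := c) hα0 (by linarith),
      expPower_add_twicePower_notMem hα0 hp.le ?_ ?_ ?_⟩
    · exact div_le_div_of_nonneg_right (by linarith) hp0.le
    · refine lt_of_mul_lt_mul_right ?_ hp0.le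
      rw [add_mul, hbp, hcp]
      linarith
    · refine mul_right_cancel₀ hp0.ne' ?_
      linear_combination (-2) * hbp - (p - 2) * hcp + hεp

theorem theorem1p1 (α p : ℝ) (hα0 : 0 < α) (hα1 : α < 1) (hp0 : 0 < p) (hp2 : p ≠ 2)
    (hαp : 1 / 2 < α + p) :
    (∃ f ∈ classA α p, ∃ g ∈ classA α p, f + g ∉ classA α p) ∧
      ¬ ∃ V : Submodule ℂ (ℂ → ℂ), (V : Set (ℂ → ℂ)) = classA α p := by
  have h := exists_add_notMem_classA hα0 hα1 hp0 hp2
  refine ⟨h, ?_⟩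
  rintro ⟨V, hV⟩
  obtain ⟨f, hf, g, hg, hfg⟩ := h
  rw [← hV] at hf hg hfg
  exact hfg (V.add_mem hf hg)
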